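/- Let $K\subseteq\mathbb C$ be a field, let $\mathbf f=(f_1,\dots,f_N)$ be a finite system of polynomials in $K[x_1,\dots,x_n]$, and let $\xi\in\mathbb C^n$ be an isolated root of $\mathbf f$. For a system $\mathbf g$ in $K[x_1,\dots,x_n]$ with ideal $I=\langle \mathbf g\rangle\subseteq\mathbb C[x_1,\dots,x_n]$, let $\mathscr D(\mathbf g)$ be the space of all $\Lambda=\sum_\beta c_\beta\,\partial^\beta\in\mathbb C[\partial_1,\dots,\partial_n]$ such that $\sum_\beta c_\beta\,(\partial^\beta p)(\xi)=0$ for all $p\in I$, and let $\mathscr D_t(\mathbf g)$ be its subspace of elements of degree at most $t$. The multiplicity of $\xi$ is $\delta_\xi(\mathbf g)=\dim_{\mathbb C}\mathscr D(\mathbf g)$, and the nil-index $o_\xi(\mathbf g)$ is the smallest $t\ge 0$ with $\mathscr D_{t+1}(\mathbf g)=\mathscr D_t(\mathbf g)$. The point $\xi$ is a simple root of $\mathbf g$ if it is a root of $\mathbf g$ with $\delta_\xi(\mathbf g)=1$. Let $J_{\mathbf g}(x)$ be the Jacobian matrix of $\mathbf g$ and $r=\operatorname{rank}J_{\mathbf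 g}(\xi)$. Reorder the polynomials and the variables so that the upper left $r\times r$ block $A(x)$ of $J_{\mathbf g}(x)$ is invertible at $\xi$, and let $B(x)$ be the upper right $r\times(n-r)$ block. Let $\lambda_1(x),\dots,\lambda_{n-r}(x)\in K[x]^n$ be the columns of $\det(A)\begin{bmatrix}-A^{-1}B\\ \mathrm{Id}\end{bmatrix}$ (of the identity matrix if $r=0$) and put $\Lambda_i(p)=\sum_{j=1}^n\lambda_{i,j}\,\partial_j p$. For a non-empty set $\boldsymbol i\subseteq\{1,\dots,n-r\}$, the $\boldsymbol i$-deflated system of $\mathbf g$ consists of $\mathbf g$ together with $\Lambda_i(\mathbf g)$ for all $i\in\boldsymbol i$. (It is defined only if $r<n$, and it depends on the chosen block and on $\boldsymbol i$.) Starting from $\mathbf f^{(0)}=\mathbf f$, let $\mathbf f^{(k+1)}$ be an $\boldsymbol i_{k+1}$-deflated system of $\mathbf f^{(k)}$, for arbitrary choices of the blocks and of the non-empty index sets $\boldsymbol i_{k+1}$, as long as $\mathbf f^{(k)}$ has a deflated system. Then there exists $k\le o_\xi(\mathbf f)$ such that $\mathbf f^{(k)}$ is reached by $k$ such deflations and $\xi$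 is a simple root of $\mathbf f^{(k)}$. -/

import Mathlib

open MvPolynomial Matrix Topology Filter

noncomputable section

namespace Deflation

/-! ### Polynomial systems over a field `K ⊆ ℂ`, and their roots in `ℂⁿ` -/

/-- A finite system `(f₁, …, f_N)` of polynomials in `K[x₁, …, xₙ]`; the number `N` of
polynomials is the length of the list. -/
abbrev PolySystem (K : Type*) [Field K] (n : ℕ) := List (MvPolynomial (Fin n) K)

section

variable {K : Type*} [Field K] [Algebra K ℂ] {n : ℕ}

/-- `ξ ∈ ℂⁿ` is a common zero of the system `f`. -/
def IsRoot (f : PolySystem K n) (ξ : Fin n → ℂ) : Prop :=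
  ∀ p ∈ f, aeval ξ p = 0

/-- `ξ` is an isolated root: it is the only root of `f` in some neighbourhood of `ξ` in `ℂⁿ`. -/
def IsIsolatedRoot (f : PolySystem K n) (ξ : Fin n → ℂ) : Prop :=
  IsRoot f ξ ∧ ∀ᶠ z in 𝓝 ξ, IsRoot f z → z = ξ

/-- The ideal of `ℂ[x₁, …, xₙ]` generated by the system `f`. -/
def systemIdeal (f : PolySystem K n) : Ideal (MvPolynomial (Fin n) ℂ) :=
  Ideal.span {q | ∃ p ∈ f, q = MvPolynomial.map (algebraMap K ℂ) p}

/-! ### The inverse system at a point -/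

/-- The iterated partial derivative `∂^β = ∂₁^β₁ ⋯ ∂ₙ^βₙ` on `ℂ[x₁, …, xₙ]`. -/
def iterPderiv (β : Fin n →₀ ℕ) : Module.End ℂ (MvPolynomial (Fin n) ℂ) :=
  ((List.finRange n).map fun i =>
    ((pderiv i : Derivation ℂ (MvPolynomial (Fin n) ℂ) (MvPolynomial (Fin n) ℂ)) :
      Module.End ℂ (MvPolynomial (Fin n) ℂ)) ^ β i).prod

/-- A polynomial `Λ = ∑ c_β ∂^β` in the symbols `∂₁, …, ∂ₙ`, read as the linear form
`p ↦ ∑ c_β (∂^β p)(ξ)` on `ℂ[x₁, …, xₙ]`. -/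
def differentialForm (ξ : Fin n → ℂ) :
    MvPolynomial (Fin n) ℂ →ₗ[ℂ] Module.Dual ℂ (MvPolynomial (Fin n) ℂ) :=
  (basisMonomials (Fin n) ℂ).constr ℂ fun β =>
    (aeval ξ : MvPolynomial (Fin n) ℂ →ₐ[ℂ] ℂ).toLinearMap ∘ₗ iterPderiv β

/-- The inverse system `𝒟 = I^⊥ ∩ ℂ[∂_ξ]` of `f` at `ξ`: all polynomials `Λ` in the
`∂ᵢ` whose linear form vanishes on the ideal `I` generated by `f`. -/
def inverseSystem (f : PolySystem K n) (ξ : Fin n → ℂ) :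
    Submodule ℂ (MvPolynomial (Fin n) ℂ) :=
  (((systemIdeal f).restrictScalars ℂ).dualAnnihilator).comap (differentialForm ξ)

/-- `𝒟_t`, the elements of the inverse system of order at most `t`. -/
def inverseSystemLE (f : PolySystem K n) (ξ : Fin n → ℂ) (t : ℕ) :
    Submodule ℂ (MvPolynomial (Fin n) ℂ) :=
  inverseSystem f ξ ⊓ restrictTotalDegree (Fin n) ℂ t

/-- The multiplicity `δ_ξ(f)`, the dimension of the inverse system. -/
def multiplicity (f : PolySystem K n) (ξ : Fin n → ℂ) : ℕ :=
  Module.finrank ℂ (inverseSystem f ξ)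

/-- The nil-index `o_ξ(f)`, the smallest `t` with `𝒟_{t+1} = 𝒟_t`. -/
def nilIndex (f : PolySystem K n) (ξ : Fin n → ℂ) : ℕ :=
  sInf {t : ℕ | inverseSystemLE f ξ (t + 1) = inverseSystemLE f ξ t}

/-- A simple root is a root of multiplicity one. -/
def IsSimpleRoot (f : PolySystem K n) (ξ : Fin n → ℂ) : Prop :=
  IsRoot f ξ ∧ multiplicity f ξ = 1

/-! ### Deflation by first order differentials -/

/-- The Jacobian matrix `[∂ⱼ fᵢ]` of the system, with polynomial entries. -/
def jacobian (f : PolySystem K n) :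
    Matrix (Fin f.length) (Fin n) (MvPolynomial (Fin n) K) :=
  Matrix.of fun i j => pderiv j (f.get i)

/-- The Jacobian matrix of the system evaluated at `ξ ∈ ℂⁿ`. -/
def jacobianAt (f : PolySystem K n) (ξ : Fin n → ℂ) : Matrix (Fin f.length) (Fin n) ℂ :=
  (jacobian f).map (aeval ξ)

/-- Let `A` be the square block of the matrix `J` on the chosen rows and columns and let `b` be the
part of column `j` of `J` in the chosen rows. This is the vector with entries `-(det A) A⁻¹ b`
(written `-(adj A) b`) in the chosen columns, `det A` in position `j`, and `0` elsewhere; that is,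
for `j` not a chosen column, the column of `det A · [-A⁻¹ B; Id]` belonging to `j`. -/
def kernelVector {R : Type*} [CommRing R] {N r : ℕ} (J : Matrix (Fin N) (Fin n) R)
    (rows : Fin r → Fin N) (cols : Fin r → Fin n) (j : Fin n) : Fin n → R :=
  Pi.single j (J.submatrix rows cols).det -
    ∑ a, Pi.single (cols a) (((J.submatrix rows cols).adjugate *ᵥ fun b => J (rows b) j) a)

/-- The first order differential operator `p ↦ ∑ₗ λₗ(x) ∂ₗ p` with polynomial coefficients. -/
def applyDifferential (lam : Fin n → MvPolynomial (Fin n) K) (p : MvPolynomial (Fin n) K) :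
    MvPolynomial (Fin n) K :=
  ∑ l, lam l * pderiv l p

/-- The system `{f, Λ_{j}(f) for j ∈ S}`, where `Λ_j` is the differential whose coefficients are
the kernel vector of the Jacobian matrix for the chosen block and the column `j`. -/
def deflate (f : PolySystem K n) {r : ℕ} (rows : Fin r → Fin f.length) (cols : Fin r → Fin n)
    (S : Finset (Fin n)) : PolySystem K n :=
  f ++ (S.sort (· ≤ ·)).flatMap fun j =>
    f.map (applyDifferential (kernelVector (jacobian f) rows cols j))

/-- `g` is a deflated system of order one of `f` at `ξ`: it arises from some block `A(x)` of the
Jacobian matrix of size `r × r`, `r = rank J_f(ξ) = rank A(ξ)`, and some non-empty set `S` of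
indices among the remaining `n - r` columns. -/
def IsDeflatedSystem (ξ : Fin n → ℂ) (f g : PolySystem K n) : Prop :=
  ∃ (r : ℕ) (rows : Fin r → Fin f.length) (cols : Fin r → Fin n) (S : Finset (Fin n)),
    r = (jacobianAt f ξ).rank ∧
    ((jacobianAt f ξ).submatrix rows cols).det ≠ 0 ∧
    S.Nonempty ∧ (∀ j ∈ S, j ∉ Set.range cols) ∧
    g = deflate f rows cols S

end

end Deflation

end

noncomputable section

namespace Deflation

/-! ### Non-isolated points of positive dimensional affine varieties -/

theorem pow_card_le_norm_multiset_prod (s : Multiset ℂ) {r : ℝ} (hr : 0 ≤ r)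
    (h : ∀ t ∈ s, r ≤ ‖t‖) : r ^ s.card ≤ ‖s.prod‖ := by
  induction s using Multiset.induction_on with
  | empty => simp
  | cons a s ih =>
    have h1 := ih fun t ht => h t (Multiset.mem_cons_of_mem ht)
    have h2 := h a (Multiset.mem_cons_self a s)
    rw [Multiset.card_cons, Multiset.prod_cons, norm_mul, pow_succ']
    exact mul_le_mul h2 h1 (by positivity) (norm_nonneg a)

theorem exists_isRoot_norm_pow_le {P : Polynomial ℂ} (hP : P.Monic) (hdeg : P.natDegree ≠ 0) :
    ∃ t, P.IsRoot t ∧ ‖t‖ ^ P.natDegree ≤ ‖P.coeff 0‖ := by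
  have hs := IsAlgClosed.splits P
  have hcard := hs.natDegree_eq_card_roots
  have hne : P.roots.toFinset.Nonempty := by
    rw [Multiset.toFinset_nonempty]
    intro h
    rw [h] at hcard
    exact hdeg (by simpa using hcard)
  obtain ⟨t, ht, hmin⟩ := Finset.exists_min_image P.roots.toFinset (fun t => ‖t‖) hne
  refine ⟨t, Polynomial.isRoot_of_mem_roots (Multiset.mem_toFinset.1 ht), ?_⟩
  have h := pow_card_le_norm_multiset_prod P.roots (norm_nonneg t)
    fun s hs => hmin s (Multiset.mem_toFinset.2 hs)
  rw [← hcard] at h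
  rw [hs.coeff_zero_eq_prod_roots_of_monic hP]
  simpa using h

theorem norm_le_of_isRoot_of_monic {P : Polynomial ℂ} (hP : P.Monic) {t : ℂ} (ht : P.IsRoot t) :
    ‖t‖ ≤ (∑ j ∈ Finset.range P.natDegree, ‖P.coeff j‖) + 1 := by
  have h := Polynomial.IsRoot.norm_lt_cauchyBound hP.ne_zero ht
  have h2 : P.cauchyBound ≤ (∑ j ∈ Finset.range P.natDegree, ‖P.coeff j‖₊) + 1 := by
    rw [Polynomial.cauchyBound, hP.leadingCoeff, nnnorm_one, div_one]
    gcongr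
    refine Finset.sup_le fun j hj => ?_
    exact Finset.single_le_sum (f := fun j => ‖P.coeff j‖₊) (fun _ _ => zero_le) hj
  have h3 := h.le.trans h2
  rw [← NNReal.coe_le_coe] at h3
  simpa using h3

/-- Over an integrally closed base `B`, a point `ψ` of `B` together with a root `t` of the minimal
polynomial of `h` at that point lifts to a point of the integral extension `A`. -/
theorem exists_algHom_lift_of_isRoot_minpoly {A B : Type*} [CommRing B] [IsDomain B]
    [IsIntegrallyClosed B] [CommRing A] [IsDomain A] [Algebra ℂ B] [Algebra ℂ A] [Algebra B A]
    [IsScalarTower ℂ B A] [Module.IsTorsionFree B A] [Algebra.IsIntegral B A]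
    (ψ : B →ₐ[ℂ] ℂ) (h : A) (t : ℂ) (ht : ((minpoly B h).map (ψ : B →+* ℂ)).IsRoot t) :
    ∃ φ : A →ₐ[ℂ] ℂ, (∀ b, φ (algebraMap B A b) = ψ b) ∧ φ h = t := by
  let e : Polynomial B →+* A := (Polynomial.aeval h).toRingHom
  let : Algebra (Polynomial B) A := e.toAlgebra
  have he : algebraMap (Polynomial B) A = e := rfl
  have : IsScalarTower B (Polynomial B) A := IsScalarTower.of_algebraMap_eq' (by
    ext b; simp [he, e])
  have : Algebra.IsIntegral (Polynomial B) A := Algebra.IsIntegral.tower_top B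
  let θ : Polynomial B →+* ℂ := Polynomial.eval₂RingHom (ψ : B →+* ℂ) t
  have hle : (⊥ : Ideal A).comap (algebraMap (Polynomial B) A) ≤ RingHom.ker θ := by
    intro p hp
    have hp0 : Polynomial.aeval h p = 0 := hp
    obtain ⟨q, rfl⟩ := minpoly.isIntegrallyClosed_dvd (Algebra.IsIntegral.isIntegral h) hp0
    rw [RingHom.mem_ker, map_mul]
    have : θ (minpoly B h) = 0 := by
      rw [Polynomial.IsRoot, Polynomial.eval_map] at ht
      exact ht
    rw [this, zero_mul]
  have : (RingHom.ker θ).IsPrime := RingHom.ker_isPrime θ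
  obtain ⟨Q, -, hQ, hQc⟩ := Ideal.exists_ideal_over_prime_of_isIntegral (RingHom.ker θ) ⊥ hle
  have hmk : ∀ b : B, Ideal.Quotient.mk Q (algebraMap B A b) = algebraMap ℂ (A ⧸ Q) (ψ b) := by
    intro b
    have h1 : (Polynomial.C (b - algebraMap ℂ B (ψ b)) : Polynomial B) ∈ RingHom.ker θ := by
      simp [RingHom.mem_ker, θ]
    rw [← hQc, Ideal.mem_comap, ← Ideal.Quotient.eq_zero_iff_mem] at h1
    have h2 : algebraMap (Polynomial B) A (Polynomial.C (b - algebraMap ℂ B (ψ b))) =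
        algebraMap B A b - algebraMap ℂ A (ψ b) := by
      rw [IsScalarTower.algebraMap_apply ℂ B A, ← map_sub]
      simp [he, e]
    rw [h2, map_sub, sub_eq_zero] at h1
    rw [h1]; rfl
  have : Algebra.IsIntegral ℂ (A ⧸ Q) := by
    refine ⟨fun x => ?_⟩
    obtain ⟨a, rfl⟩ := Ideal.Quotient.mk_surjective x
    obtain ⟨p, hp, hpa⟩ := Algebra.IsIntegral.isIntegral (R := B) a
    refine ⟨p.map (ψ : B →+* ℂ), hp.map _, ?_⟩
    rw [Polynomial.eval₂_map]
    have : (algebraMap ℂ (A ⧸ Q)).comp (ψ : B →+* ℂ) =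
        (Ideal.Quotient.mk Q).comp (algebraMap B A) := by
      ext b; exact (hmk b).symm
    rw [this, ← Polynomial.hom_eval₂, hpa, map_zero]
  let E : ℂ ≃ₐ[ℂ] (A ⧸ Q) := AlgEquiv.ofBijective (Algebra.ofId ℂ (A ⧸ Q))
    IsAlgClosed.algebraMap_bijective_of_isIntegral
  have hE : ∀ c, E.symm (algebraMap ℂ (A ⧸ Q) c) = c := fun c => by simp
  refine ⟨E.symm.toAlgHom.comp (Ideal.Quotient.mkₐ ℂ Q), fun b => ?_, ?_⟩
  · change E.symm (Ideal.Quotient.mk Q (algebraMap B A b)) = ψ b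
    rw [hmk, hE]
  · change E.symm (Ideal.Quotient.mk Q h) = t
    have h1 : (Polynomial.X - Polynomial.C (algebraMap ℂ B t) : Polynomial B) ∈ RingHom.ker θ := by
      simp [RingHom.mem_ker, θ]
    rw [← hQc, Ideal.mem_comap, ← Ideal.Quotient.eq_zero_iff_mem] at h1
    have h2 : algebraMap (Polynomial B) A (Polynomial.X - Polynomial.C (algebraMap ℂ B t)) =
        h - algebraMap ℂ A t := by
      rw [IsScalarTower.algebraMap_apply ℂ B A]
      simp [he, e]
    rw [h2, map_sub, sub_eq_zero] at h1
    rw [h1]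
    exact hE t

/-- A polynomial vanishing at `ξ` and at no other point of a given finite set. -/
theorem exists_aeval_eq_zero_of_finite {n : ℕ} (ξ : Fin n → ℂ) {s : Set (Fin n → ℂ)}
    (hs : s.Finite) :
    ∃ h : MvPolynomial (Fin n) ℂ, aeval ξ h = 0 ∧ ∀ z ∈ s, aeval z h = 0 → z = ξ := by
  have key : ∃ e : MvPolynomial (Fin n) ℂ, aeval ξ e ≠ 0 ∧ ∀ z ∈ s, z ≠ ξ → aeval z e = 0 := by
    induction s, hs using Set.Finite.induction_on with
    | empty => exact ⟨1, by simp, by simp⟩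
    | @insert a s _ _ ih =>
      obtain ⟨e, he, hes⟩ := ih
      by_cases ha : a = ξ
      · exact ⟨e, he, fun z hz hne => by
          rcases Set.mem_insert_iff.1 hz with rfl | hz
          · exact absurd ha hne
          · exact hes z hz hne⟩
      · obtain ⟨i, hi⟩ := Function.ne_iff.1 ha
        refine ⟨(X i - C (a i)) * e, ?_, fun z hz hne => ?_⟩
        · rw [map_mul]
          refine mul_ne_zero ?_ he
          simpa [sub_eq_zero] using hi.symm
        · rcases Set.mem_insert_iff.1 hz with rfl | hz
          · simp
          · rw [map_mul, hes z hz hne, mul_zero]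
  obtain ⟨e, he, hes⟩ := key
  refine ⟨C (aeval ξ e) - e, by simp, fun z hz h => ?_⟩
  by_contra hne
  rw [map_sub, hes z hz hne] at h
  simp at h
  exact he h

theorem continuous_aeval_left {n : ℕ} (q : MvPolynomial (Fin n) ℂ) :
    Continuous fun z : Fin n → ℂ => aeval z q := by
  simpa [coe_aeval_eq_eval] using MvPolynomial.continuous_eval q

/-- A prime ideal strictly contained in the maximal ideal of `ξ` has zeros other than `ξ` in every
neighbourhood of `ξ`. -/
theorem exists_mem_zeroLocus_ne_of_isPrime {n : ℕ} {ξ : Fin n → ℂ}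
    {p : Ideal (MvPolynomial (Fin n) ℂ)} [p.IsPrime]
    (hp : p < vanishingIdeal ℂ {ξ}) {U : Set (Fin n → ℂ)} (hU : U ∈ 𝓝 ξ) :
    ∃ z ∈ U, z ≠ ξ ∧ ∀ q ∈ p, aeval z q = 0 := by
  let A := MvPolynomial (Fin n) ℂ ⧸ p
  let mk : MvPolynomial (Fin n) ℂ →ₐ[ℂ] A := Ideal.Quotient.mkₐ ℂ p
  have hmk : Function.Surjective mk := Ideal.Quotient.mkₐ_surjective ℂ p
  have hpt : ∀ (φ : A →ₐ[ℂ] ℂ) (q), aeval (fun i => φ (mk (X i))) q = φ (mk q) := by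
    intro φ q
    have : aeval (fun i => φ (mk (X i))) = φ.comp mk := by
      ext i; simp
    rw [this]; rfl
  have hpt0 : ∀ (φ : A →ₐ[ℂ] ℂ), ∀ q ∈ p, aeval (fun i => φ (mk (X i))) q = 0 := by
    intro φ q hq
    have : mk q = 0 := Ideal.Quotient.eq_zero_iff_mem.2 hq
    rw [hpt, this, map_zero]
  obtain ⟨d, g, hginj, hgint⟩ := exists_integral_inj_algHom_of_fg ℂ A
  let B := MvPolynomial (Fin d) ℂ
  let _ : Algebra B A := g.toRingHom.toAlgebra
  have hg : ∀ b : B, algebraMap B A b = g b := fun b => rfl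
  have : IsScalarTower ℂ B A := IsScalarTower.of_algebraMap_eq fun c => by
    rw [hg, AlgHom.commutes]
  have : Algebra.IsIntegral B A := ⟨hgint⟩
  have : FaithfulSMul B A := (faithfulSMul_iff_algebraMap_injective B A).2 hginj
  have hd : d ≠ 0 := by
    rintro rfl
    have hint : Algebra.IsIntegral ℂ A := by
      have : Algebra.IsIntegral ℂ B := ⟨fun x => by
        rw [MvPolynomial.eq_C_of_isEmpty x]
        exact isIntegral_algebraMap⟩
      exact Algebra.IsIntegral.trans B
    have hmax : p.IsMaximal :=
      Ideal.Quotient.maximal_of_isField p (isField_of_isIntegral_of_isField' (Field.toIsField ℂ))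
    have := hmax.eq_of_le (Ideal.IsPrime.ne_top inferInstance) hp.le
    exact hp.ne this
  let φ₀ : A →ₐ[ℂ] ℂ := Ideal.Quotient.liftₐ p (aeval ξ) fun a ha =>
    (mem_vanishingIdeal_singleton_iff ξ a).1 (hp.le ha)
  have hφ₀ : ∀ q, φ₀ (mk q) = aeval ξ q := fun q => rfl
  let y₀ : Fin d → ℂ := fun j => φ₀ (g (X j))
  have hψ : ∀ φ : A →ₐ[ℂ] ℂ, ∀ b, φ (g b) = aeval (fun j => φ (g (X j))) b := by
    intro φ b
    have : φ.comp g = aeval (fun j => φ (g (X j))) := by ext j; simp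
    rw [← this]; rfl
  have hroot : ∀ (φ : A →ₐ[ℂ] ℂ) (y : Fin d → ℂ), (∀ b, φ (g b) = aeval y b) → ∀ a : A,
      ((minpoly B a).map ((aeval y : B →ₐ[ℂ] ℂ) : B →+* ℂ)).IsRoot (φ a) := by
    intro φ y hy a
    have h1 : ((aeval y : B →ₐ[ℂ] ℂ) : B →+* ℂ) = (φ : A →+* ℂ).comp (algebraMap B A) := by
      refine RingHom.ext fun b => ?_
      exact (hy b).symm
    rw [Polynomial.IsRoot, Polynomial.eval_map, h1]
    have h2 := Polynomial.hom_eval₂ (minpoly B a) (algebraMap B A) (φ : A →+* ℂ) a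
    have h3 : Polynomial.eval₂ (algebraMap B A) a (minpoly B a) = 0 := minpoly.aeval B a
    rw [h3, map_zero] at h2
    exact h2.symm
  have hmonic : ∀ a : A, (minpoly B a).Monic := fun a =>
    minpoly.monic (Algebra.IsIntegral.isIntegral a)
  -- the fibre through `ξ` is finite
  let fib : Set (Fin n → ℂ) := {z | ∃ φ : A →ₐ[ℂ] ℂ, (∀ b, φ (g b) = aeval y₀ b) ∧
    z = fun i => φ (mk (X i))}
  have hfib : fib.Finite := by
    refine (Set.Finite.pi (t := fun i => {t | ((minpoly B (mk (X i))).map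
      ((aeval y₀ : B →ₐ[ℂ] ℂ) : B →+* ℂ)).IsRoot t}) fun i => ?_).subset ?_
    · exact Polynomial.finite_setOfPred_isRoot ((hmonic _).map _).ne_zero
    · rintro z ⟨φ, hφ, rfl⟩ i -
      exact hroot φ y₀ hφ _
  obtain ⟨H, hHξ, hH⟩ := exists_aeval_eq_zero_of_finite ξ hfib
  let h : A := mk H
  let y : ℕ → Fin d → ℂ := fun k j => y₀ j + 1 / ((k : ℂ) + 1)
  have hy : Tendsto y atTop (𝓝 y₀) := by
    rw [tendsto_pi_nhds]
    intro j
    have := (tendsto_one_div_add_atTop_nhds_zero_nat (𝕜 := ℂ)).const_add (y₀ j)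
    simpa [y] using this
  have hyne : ∀ k, y k ≠ y₀ := by
    intro k hk
    have := congrFun hk ⟨0, Nat.pos_of_ne_zero hd⟩
    simp only [y, add_eq_left, one_div, inv_eq_zero] at this
    exact Nat.cast_add_one_ne_zero k this
  let D := (minpoly B h).natDegree
  have hD : D ≠ 0 := (minpoly.natDegree_pos (Algebra.IsIntegral.isIntegral h)).ne'
  have hlift : ∀ k, ∃ φ : A →ₐ[ℂ] ℂ, (∀ b, φ (g b) = aeval (y k) b) ∧
      ‖φ h‖ ^ D ≤ ‖aeval (y k) ((minpoly B h).coeff 0)‖ := by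
    intro k
    have hm := (hmonic h).map ((aeval (y k) : B →ₐ[ℂ] ℂ) : B →+* ℂ)
    have hdeg : ((minpoly B h).map ((aeval (y k) : B →ₐ[ℂ] ℂ) : B →+* ℂ)).natDegree = D :=
      (hmonic h).natDegree_map _
    obtain ⟨t, ht, htle⟩ := exists_isRoot_norm_pow_le hm (by rw [hdeg]; exact hD)
    obtain ⟨φ, hφ, hφh⟩ := exists_algHom_lift_of_isRoot_minpoly (aeval (y k)) h t ht
    refine ⟨φ, hφ, ?_⟩
    rw [hφh, ← hdeg]
    refine htle.trans (le_of_eq ?_)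
    rw [Polynomial.coeff_map]; rfl
  choose φ hφ hφh using hlift
  let z : ℕ → Fin n → ℂ := fun k i => φ k (mk (X i))
  -- the lifted points stay bounded
  have hbdd : ∀ i, ∃ M, ∀ k, ‖z k i‖ ≤ M := by
    intro i
    let Q := minpoly B (mk (X i))
    have hcont : Continuous fun v : Fin d → ℂ =>
        (∑ j ∈ Finset.range Q.natDegree, ‖aeval v (Q.coeff j)‖) + 1 :=
      (continuous_finsetSum _ fun j _ => (continuous_aeval_left _).norm).add continuous_const
    obtain ⟨M, hM⟩ := ((hcont.tendsto y₀).comp hy).bddAbove_range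
    refine ⟨M, fun k => le_trans ?_ (hM ⟨k, rfl⟩)⟩
    have := norm_le_of_isRoot_of_monic ((hmonic _).map _) (hroot (φ k) (y k) (hφ k) (mk (X i)))
    rw [(hmonic _).natDegree_map] at this
    simp only [Polynomial.coeff_map] at this
    exact this
  choose M hM using hbdd
  obtain ⟨w, -, s, hs, hzw⟩ := tendsto_subseq_of_bounded
    (s := Set.pi Set.univ fun i => Metric.closedBall (0 : ℂ) (M i))
    (Bornology.IsBounded.pi fun i => Metric.isBounded_closedBall) (x := z)
    fun k i _ => by simpa using hM i k
  have hlim : ∀ q, Tendsto (fun k => φ (s k) (mk q)) atTop (𝓝 (aeval w q)) := by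
    intro q
    have := ((continuous_aeval_left q).tendsto w).comp hzw
    refine this.congr fun k => ?_
    exact hpt (φ (s k)) q
  have hw0 : ∀ q ∈ p, aeval w q = 0 := by
    intro q hq
    have h0 : ∀ k, φ (s k) (mk q) = 0 := fun k => by
      have : mk q = 0 := Ideal.Quotient.eq_zero_iff_mem.2 hq
      rw [this, map_zero]
    have := hlim q
    simp only [h0] at this
    exact (tendsto_nhds_unique this tendsto_const_nhds)
  let φw : A →ₐ[ℂ] ℂ := Ideal.Quotient.liftₐ p (aeval w) hw0
  have hφw : ∀ q, φw (mk q) = aeval w q := fun q => rfl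
  have hys : Tendsto (fun k => y (s k)) atTop (𝓝 y₀) := hy.comp hs.tendsto_atTop
  have hwfib : w ∈ fib := by
    refine ⟨φw, fun b => ?_, ?_⟩
    · obtain ⟨q, hq⟩ := hmk (g b)
      have h1 := hlim q
      rw [hq] at h1
      simp only [hφ] at h1
      rw [← hq, hφw]
      exact tendsto_nhds_unique h1 (((continuous_aeval_left b).tendsto y₀).comp hys)
    · ext i
      rw [hφw, aeval_X]
  have hwH : aeval w H = 0 := by
    have hc0 : aeval y₀ ((minpoly B h).coeff 0) = 0 := by
      have := hroot φ₀ y₀ (hψ φ₀) h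
      have hh : φ₀ h = 0 := hHξ
      rw [hh, Polynomial.IsRoot, ← Polynomial.coeff_zero_eq_eval_zero, Polynomial.coeff_map] at this
      exact this
    have h1 : Tendsto (fun k => ‖φ (s k) h‖ ^ D) atTop (𝓝 (‖aeval w H‖ ^ D)) :=
      ((hlim H).norm).pow D
    have h2 : Tendsto (fun k => ‖aeval (y (s k)) ((minpoly B h).coeff 0)‖) atTop (𝓝 0) := by
      have := (((continuous_aeval_left ((minpoly B h).coeff 0)).tendsto y₀).comp hys).norm
      rw [hc0, norm_zero] at this
      exact this
    have h3 := le_of_tendsto_of_tendsto' h1 h2 fun k => hφh (s k)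
    have h4 : ‖aeval w H‖ ^ D = 0 := le_antisymm h3 (by positivity)
    exact norm_eq_zero.1 (pow_eq_zero_iff hD |>.1 h4)
  have hwξ : w = ξ := hH w hwfib hwH
  rw [hwξ] at hzw
  obtain ⟨k, hk⟩ := (hzw.eventually hU).exists
  refine ⟨z (s k), hk, fun heq => hyne (s k) ?_, hpt0 (φ (s k))⟩
  ext j
  obtain ⟨q, hq⟩ := hmk (g (X j))
  have h1 : φ (s k) (g (X j)) = aeval (y (s k)) (X j) := hφ _ _
  rw [aeval_X] at h1
  rw [← h1, ← hq]
  have h2 : aeval (z (s k)) q = φ (s k) (mk q) := hpt (φ (s k)) q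
  rw [← h2, heq]
  change _ = φ₀ (g (X j))
  rw [← hq, hφ₀]

/-- A prime which is minimal over `I` is, locally, nilpotent modulo `I`. -/
theorem exists_mul_pow_mem_of_mem_minimalPrimes {R : Type*} [CommRing R] {I p : Ideal R}
    (hp : p ∈ I.minimalPrimes) {x : R} (hx : x ∈ p) : ∃ s ∉ p, ∃ N : ℕ, s * x ^ N ∈ I := by
  have := hp.isPrime
  have h := IsLocalization.AtPrime.radical_map_of_mem_minimalPrimes (Localization.AtPrime p) p I hp
  have hx' : algebraMap R (Localization.AtPrime p) x ∈
      (I.map (algebraMap R (Localization.AtPrime p))).radical := by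
    rw [h]; exact Ideal.mem_map_of_mem _ hx
  obtain ⟨N, hN⟩ := hx'
  rw [← map_pow, IsLocalization.algebraMap_mem_map_algebraMap_iff p.primeCompl] at hN
  obtain ⟨s, hs, hsx⟩ := hN
  exact ⟨s, hs, N, hsx⟩

section

variable {K : Type*} [Field K] [Algebra K ℂ] {n : ℕ}

theorem aeval_map_eq (z : Fin n → ℂ) (q : MvPolynomial (Fin n) K) :
    aeval z (MvPolynomial.map (algebraMap K ℂ) q) = aeval z q := by
  rw [aeval_map_algebraMap]

theorem IsRoot.systemIdeal_le {f : PolySystem K n} {ξ : Fin n → ℂ} (h : IsRoot f ξ) :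
    systemIdeal f ≤ vanishingIdeal ℂ {ξ} := by
  refine Ideal.span_le.2 ?_
  rintro _ ⟨q, hq, rfl⟩
  rw [SetLike.mem_coe, mem_vanishingIdeal_singleton_iff, aeval_map_eq]
  exact h q hq

theorem IsIsolatedRoot.mem_minimalPrimes {f : PolySystem K n} {ξ : Fin n → ℂ}
    (h : IsIsolatedRoot f ξ) : vanishingIdeal ℂ {ξ} ∈ (systemIdeal f).minimalPrimes := by
  obtain ⟨p, hp, hple⟩ := Ideal.exists_minimalPrimes_le h.1.systemIdeal_le
  have := hp.isPrime
  rcases hple.eq_or_lt with rfl | hlt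
  · exact hp
  · obtain ⟨z, hz, hne, hz0⟩ := exists_mem_zeroLocus_ne_of_isPrime hlt h.2
    refine absurd (hz fun q hq => ?_) hne
    rw [← aeval_map_eq]
    exact hz0 _ (hp.1.2 (Ideal.subset_span ⟨q, hq, rfl⟩))

end

/-! ### The pairing of differential operators with polynomials -/

theorem pderiv_pderiv_comm {σ R : Type*} [CommRing R] (i j : σ) (p : MvPolynomial σ R) :
    pderiv i (pderiv j p) = pderiv j (pderiv i p) := by
  classical
  have h : ⁅pderiv (R := R) i, pderiv (R := R) j⁆ = 0 := by
    refine MvPolynomial.derivation_ext fun k => ?_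
    rw [Derivation.commutator_apply]
    simp only [pderiv_X, Pi.single_apply]
    split_ifs <;> simp
  have h2 := congrArg (fun D : Derivation R (MvPolynomial σ R) (MvPolynomial σ R) => D p) h
  simpa [Derivation.commutator_apply, sub_eq_zero] using h2

theorem list_prod_pow_add_single {ι M : Type*} [DecidableEq ι] [Monoid M] (a : ι → M)
    (ha : ∀ i j, Commute (a i) (a j)) (β : ι → ℕ) (j : ι) (l : List ι) (hl : l.Nodup) :
    (l.map fun i => a i ^ (β i + (Pi.single j 1 : ι → ℕ) i)).prod =
      (l.map fun i => a i ^ β i).prod * if j ∈ l then a j else 1 := by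
  induction l with
  | nil => simp
  | cons b l ih =>
    rw [List.nodup_cons] at hl
    rw [List.map_cons, List.prod_cons, ih hl.2, List.map_cons, List.prod_cons]
    by_cases hb : j = b
    · subst hb
      have hc : Commute (a j) (l.map fun i => a i ^ β i).prod :=
        Commute.list_prod_right _ _ fun x hx => by
          obtain ⟨i, -, rfl⟩ := List.mem_map.1 hx
          exact (ha j i).pow_right _
      simp only [Pi.single_eq_same, hl.1, if_false, List.mem_cons, true_or, if_true, mul_one,
        pow_succ, mul_assoc]
      rw [hc.eq]
    · simp [hb, mul_assoc]

variable {n : ℕ}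

theorem iterPderiv_zero : iterPderiv (0 : Fin n →₀ ℕ) = 1 := by
  simp [iterPderiv]

theorem iterPderiv_add_single (β : Fin n →₀ ℕ) (j : Fin n) (q : MvPolynomial (Fin n) ℂ) :
    iterPderiv (β + Finsupp.single j 1) q = iterPderiv β (pderiv j q) := by
  have h := list_prod_pow_add_single (fun i : Fin n =>
    ((pderiv i : Derivation ℂ (MvPolynomial (Fin n) ℂ) (MvPolynomial (Fin n) ℂ)) :
      Module.End ℂ (MvPolynomial (Fin n) ℂ)))
    (fun i j => LinearMap.ext fun p => pderiv_pderiv_comm i j p) β j _ (List.nodup_finRange n)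
  rw [if_pos (List.mem_finRange j)] at h
  have h2 : iterPderiv (β + Finsupp.single j 1) = iterPderiv β *
      ((pderiv j : Derivation ℂ (MvPolynomial (Fin n) ℂ) (MvPolynomial (Fin n) ℂ)) :
      Module.End ℂ (MvPolynomial (Fin n) ℂ)) := by
    rw [iterPderiv, iterPderiv, ← h]
    simp only [Finsupp.add_apply, Finsupp.single_eq_pi_single]
  rw [h2]; rfl

theorem differentialForm_monomial (ξ : Fin n → ℂ) (β : Fin n →₀ ℕ) (c : ℂ)
    (q : MvPolynomial (Fin n) ℂ) :
    differentialForm ξ (monomial β c) q = c * aeval ξ (iterPderiv β q) := by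
  have h : monomial β c = c • basisMonomials (Fin n) ℂ β := by
    simp [smul_monomial]
  rw [h, map_smul, differentialForm, Module.Basis.constr_basis]
  rfl

theorem differentialForm_C (ξ : Fin n → ℂ) (c : ℂ) (q : MvPolynomial (Fin n) ℂ) :
    differentialForm ξ (C c) q = c * aeval ξ q := by
  rw [C_apply, differentialForm_monomial, iterPderiv_zero]; rfl

theorem differentialForm_mul_X (ξ : Fin n → ℂ) (Λ : MvPolynomial (Fin n) ℂ) (j : Fin n)
    (q : MvPolynomial (Fin n) ℂ) :
    differentialForm ξ (Λ * X j) q = differentialForm ξ Λ (pderiv j q) := by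
  induction Λ using MvPolynomial.induction_on' with
  | monomial β c =>
    rw [X, monomial_mul, mul_one, differentialForm_monomial, differentialForm_monomial,
      iterPderiv_add_single]
  | add p q hp hq => simp only [add_mul, map_add, LinearMap.add_apply, hp, hq]

theorem differentialForm_pderiv (ξ : Fin n → ℂ) (Λ : MvPolynomial (Fin n) ℂ) (j : Fin n)
    (q : MvPolynomial (Fin n) ℂ) :
    differentialForm ξ (pderiv j Λ) q = differentialForm ξ Λ ((X j - C (ξ j)) * q) := by
  classical
  induction Λ using MvPolynomial.induction_on generalizing q with
  | C c => simp [differentialForm_C]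
  | add p q hp hq => simp only [map_add, LinearMap.add_apply, hp, hq]
  | mul_X p i ih =>
    rw [differentialForm_mul_X, Derivation.leibniz, Derivation.leibniz, map_add, map_add,
      LinearMap.add_apply, smul_eq_mul, smul_eq_mul, smul_eq_mul, smul_eq_mul, mul_comm (X i),
      differentialForm_mul_X, ih, map_sub, pderiv_C, sub_zero, pderiv_X, pderiv_X, add_comm]
    congr 1
    by_cases h : i = j
    · subst h; simp
    · simp [Pi.single_eq_of_ne h, Pi.single_eq_of_ne (Ne.symm h)]

/-! ### Filtration by degree -/

/-- The polynomials all of whose monomials have degree less than `d`. -/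
def degreeLT (n d : ℕ) : Submodule ℂ (MvPolynomial (Fin n) ℂ) where
  carrier := {Λ | ∀ β : Fin n →₀ ℕ, d ≤ β.degree → coeff β Λ = 0}
  zero_mem' := by simp
  add_mem' := fun ha hb β hβ => by rw [coeff_add, ha β hβ, hb β hβ, add_zero]
  smul_mem' := fun c a ha β hβ => by rw [coeff_smul, ha β hβ, smul_zero]

theorem degreeLT_mono {d e : ℕ} (h : d ≤ e) : degreeLT n d ≤ degreeLT n e :=
  fun _ hΛ β hβ => hΛ β (h.trans hβ)

theorem mem_degreeLT_succ_iff {d : ℕ} {Λ : MvPolynomial (Fin n) ℂ} :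
    Λ ∈ degreeLT n (d + 1) ↔ Λ.totalDegree ≤ d := by
  constructor
  · intro h
    refine Finset.sup_le fun β hβ => ?_
    by_contra hlt
    exact mem_support_iff.1 hβ (h β (Nat.lt_of_not_le hlt))
  · intro h β hβ
    by_contra hne
    have := le_totalDegree (mem_support_iff.2 hne)
    have h2 : β.degree ≤ Λ.totalDegree := this
    omega

theorem restrictTotalDegree_eq_degreeLT (d : ℕ) :
    restrictTotalDegree (Fin n) ℂ d = degreeLT n (d + 1) := by
  ext Λ
  rw [mem_restrictTotalDegree, mem_degreeLT_succ_iff]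

theorem eq_zero_of_mem_degreeLT_zero {Λ : MvPolynomial (Fin n) ℂ} (h : Λ ∈ degreeLT n 0) :
    Λ = 0 := by
  ext β; simpa using h β (Nat.zero_le _)

theorem eq_C_of_mem_degreeLT_one {Λ : MvPolynomial (Fin n) ℂ} (h : Λ ∈ degreeLT n 1) :
    Λ = C (coeff 0 Λ) :=
  totalDegree_eq_zero_iff_eq_C.1 (Nat.le_zero.1 (mem_degreeLT_succ_iff.1 h))

theorem exists_mem_degreeLT (Λ : MvPolynomial (Fin n) ℂ) : ∃ d, Λ ∈ degreeLT n d :=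
  ⟨_, mem_degreeLT_succ_iff.2 le_rfl⟩

theorem pderiv_mem_degreeLT {d : ℕ} {Λ : MvPolynomial (Fin n) ℂ} (h : Λ ∈ degreeLT n (d + 1))
    (i : Fin n) : pderiv i Λ ∈ degreeLT n d := by
  intro β hβ
  rw [coeff_pderiv, h, zero_mul]
  rw [map_add, Finsupp.degree_single]
  omega

theorem mem_degreeLT_succ_of_pderiv {d : ℕ} {Λ : MvPolynomial (Fin n) ℂ}
    (h : ∀ i, pderiv i Λ ∈ degreeLT n d) : Λ ∈ degreeLT n (d + 1) := by
  intro β hβ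
  have hne : β ≠ 0 := by rintro rfl; simp at hβ
  obtain ⟨i, hi⟩ := Finsupp.ne_iff.1 hne
  obtain ⟨γ, rfl⟩ : ∃ γ, β = γ + Finsupp.single i 1 :=
    ⟨β - Finsupp.single i 1, (tsub_add_cancel_of_le
      (Finsupp.single_le_iff.2 (Nat.one_le_iff_ne_zero.2 hi))).symm⟩
  rw [map_add, Finsupp.degree_single] at hβ
  have h1 := h i γ (by omega)
  rw [coeff_pderiv] at h1
  exact (mul_eq_zero.1 h1).resolve_right (Nat.cast_add_one_ne_zero _)

theorem mul_X_mem_degreeLT {d : ℕ} {Λ : MvPolynomial (Fin n) ℂ} (h : Λ ∈ degreeLT n d)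
    (i : Fin n) : Λ * X i ∈ degreeLT n (d + 1) := by
  cases d with
  | zero => rw [eq_zero_of_mem_degreeLT_zero h, zero_mul]; exact zero_mem _
  | succ d =>
    rw [mem_degreeLT_succ_iff] at h ⊢
    exact (totalDegree_mul _ _).trans (add_le_add h (totalDegree_X i).le)

theorem mem_degreeLT_of_linear_mul_mem {d : ℕ} {Λ : MvPolynomial (Fin n) ℂ} {a : Fin n → ℂ}
    (ha : a ≠ 0) (h : ∑ l, a l • (Λ * X l) ∈ degreeLT n (d + 1)) : Λ ∈ degreeLT n d := by
  by_cases hΛ : Λ = 0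
  · rw [hΛ]; exact zero_mem _
  let L : MvPolynomial (Fin n) ℂ := ∑ l, a l • X l
  obtain ⟨i, hi⟩ := Function.ne_iff.1 ha
  have hcoeff : coeff (Finsupp.single i 1) L = a i := by
    simp [L, coeff_sum, coeff_X, Finsupp.single_left_inj]
  have hL0 : L ≠ 0 := fun h0 => by
    rw [h0, coeff_zero] at hcoeff
    exact hi hcoeff.symm
  have hL1 : 1 ≤ L.totalDegree := by
    have : (Finsupp.single i 1 : Fin n →₀ ℕ) ∈ L.support := by
      rw [mem_support_iff, hcoeff]; exact hi
    simpa using le_totalDegree this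
  have hsum : ∑ l, a l • (Λ * X l) = Λ * L := by
    simp [L, Finset.mul_sum]
  rw [hsum, mem_degreeLT_succ_iff, totalDegree_mul_of_isDomain hΛ hL0] at h
  obtain ⟨e, rfl⟩ : ∃ e, d = e + 1 := ⟨d - 1, by omega⟩
  rw [mem_degreeLT_succ_iff]
  omega

theorem coeff_eq_zero_of_iterate_pderiv_eq_zero (i : Fin n) (N : ℕ) :
    ∀ Λ : MvPolynomial (Fin n) ℂ, (pderiv i)^[N] Λ = 0 →
      ∀ β : Fin n →₀ ℕ, N ≤ β i → coeff β Λ = 0 := by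
  induction N with
  | zero => intro Λ h β _; rw [Function.iterate_zero, id] at h; rw [h, coeff_zero]
  | succ N ih =>
    intro Λ h β hβ
    obtain ⟨γ, rfl⟩ : ∃ γ, β = γ + Finsupp.single i 1 :=
      ⟨β - Finsupp.single i 1, (tsub_add_cancel_of_le
        (Finsupp.single_le_iff.2 (by omega))).symm⟩
    have h1 := ih (pderiv i Λ) h γ (by simpa using hβ)
    rw [coeff_pderiv] at h1
    exact (mul_eq_zero.1 h1).resolve_right (Nat.cast_add_one_ne_zero _)

/-- Polynomials act on differential operators through the pairing, up to lower order by the value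
at `ξ`. -/
theorem exists_differentialForm_eq_mul (ξ : Fin n → ℂ) (Λ p : MvPolynomial (Fin n) ℂ) :
    ∃ Λ' : MvPolynomial (Fin n) ℂ,
      (∀ q, differentialForm ξ Λ' q = differentialForm ξ Λ (p * q)) ∧
      ∀ d, Λ ∈ degreeLT n (d + 1) → Λ' - aeval ξ p • Λ ∈ degreeLT n d := by
  induction p using MvPolynomial.induction_on generalizing Λ with
  | C a =>
    refine ⟨a • Λ, fun q => ?_, fun d _ => ?_⟩
    · rw [← smul_eq_C_mul, map_smul, map_smul]; rfl
    · simp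
  | add p q hp hq =>
    obtain ⟨P, hP, hPd⟩ := hp Λ
    obtain ⟨Q, hQ, hQd⟩ := hq Λ
    refine ⟨P + Q, fun r => ?_, fun d hd => ?_⟩
    · rw [map_add, LinearMap.add_apply, hP, hQ, add_mul, map_add]
    · have := add_mem (hPd d hd) (hQd d hd)
      rw [map_add, add_smul]
      convert this using 1
      abel
  | mul_X p i ih =>
    obtain ⟨P, hP, hPd⟩ := ih Λ
    refine ⟨ξ i • P + pderiv i P, fun q => ?_, fun d hd => ?_⟩
    · rw [map_add, map_smul, LinearMap.add_apply, LinearMap.smul_apply, differentialForm_pderiv, hP,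
        hP, ← map_smul, ← map_add]
      congr 1
      rw [smul_eq_C_mul]
      ring
    · have h1 := hPd d hd
      have h2 : P ∈ degreeLT n (d + 1) := by
        have := add_mem (degreeLT_mono (Nat.le_succ d) h1)
          (Submodule.smul_mem _ (aeval ξ p) hd)
        simpa using this
      have h3 := add_mem (Submodule.smul_mem _ (ξ i) h1) (pderiv_mem_degreeLT h2 i)
      convert h3 using 1
      rw [map_mul, aeval_X, smul_sub, smul_smul, mul_comm (ξ i)]
      abel

theorem eq_zero_of_differentialForm_mul_eq_zero {ξ : Fin n → ℂ} {s : MvPolynomial (Fin n) ℂ}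
    (hs : aeval ξ s ≠ 0) {Λ : MvPolynomial (Fin n) ℂ}
    (h : ∀ q, differentialForm ξ Λ (s * q) = 0) : Λ = 0 := by
  obtain ⟨d, hd⟩ := exists_mem_degreeLT Λ
  induction d generalizing Λ with
  | zero => exact eq_zero_of_mem_degreeLT_zero hd
  | succ d ih =>
    have h1 : Λ ∈ degreeLT n 1 := mem_degreeLT_succ_of_pderiv fun i => by
      rw [ih (Λ := pderiv i Λ) (fun q => ?_) (pderiv_mem_degreeLT hd i)]
      · exact zero_mem _
      · rw [differentialForm_pderiv, mul_left_comm]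
        exact h _
    rw [eq_C_of_mem_degreeLT_one h1] at h ⊢
    have h2 := h 1
    rw [mul_one, differentialForm_C] at h2
    rw [(mul_eq_zero.1 h2).resolve_right hs, map_zero]

/-! ### Blocks of maximal rank -/

theorem exists_linearIndependent_rows {F m : Type*} [Field F] [Finite m] {n r : ℕ}
    {J : Matrix m (Fin n) F} (hr : J.rank = r) :
    ∃ rows : Fin r → m, LinearIndependent F (J.submatrix rows id).row := by
  rw [Matrix.rank_eq_finrank_span_row] at hr
  subst hr
  obtain ⟨v, hv, -, hvi⟩ := Submodule.exists_fun_fin_finrank_span_eq F (Set.range J.row)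
  choose rows hrows using hv
  refine ⟨rows, ?_⟩
  have h : (J.submatrix rows id).row = v := funext hrows
  rwa [h]

theorem exists_submatrix_det_ne_zero {F : Type*} [Field F] {N n : ℕ}
    (J : Matrix (Fin N) (Fin n) F) : ∃ (rows : Fin J.rank → Fin N) (cols : Fin J.rank → Fin n),
      (J.submatrix rows cols).det ≠ 0 := by
  obtain ⟨rows, hrows⟩ := exists_linearIndependent_rows (J := J) rfl
  have h1 : (J.submatrix rows id)ᵀ.rank = J.rank := by
    rw [Matrix.rank_transpose, hrows.rank_matrix, Fintype.card_fin]
  obtain ⟨cols, hcols⟩ := exists_linearIndependent_rows h1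
  refine ⟨rows, cols, ?_⟩
  have h2 := (Matrix.isUnit_iff_isUnit_det _).1 (Matrix.linearIndependent_rows_iff_isUnit.1 hcols)
  rw [← Matrix.det_transpose]
  exact h2.ne_zero

theorem range_ne_univ_of_lt {r n : ℕ} (h : r < n) (c : Fin r → Fin n) : ∃ j, j ∉ Set.range c := by
  by_contra! hc
  have := Fintype.card_le_of_surjective c hc
  simp at this
  omega

theorem mulVec_kernelVector {F : Type*} [Field F] {N n r : ℕ} {J : Matrix (Fin N) (Fin n) F}
    {rows : Fin r → Fin N} {cols : Fin r → Fin n} (hr : r = J.rank)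
    (hdet : (J.submatrix rows cols).det ≠ 0) (j : Fin n) :
    J *ᵥ kernelVector J rows cols j = 0 := by
  set A := J.submatrix rows cols with hA
  set J' := J.submatrix rows id with hJ'
  have h1 : J' *ᵥ kernelVector J rows cols j = 0 := by
    ext b
    rw [kernelVector, mulVec_sub, Matrix.mulVec_sum]
    simp only [Matrix.mulVec_single]
    have h2 : (A *ᵥ (A.adjugate *ᵥ fun b => J (rows b) j)) b = A.det * J (rows b) j := by
      rw [mulVec_mulVec, mul_adjugate, smul_mulVec, one_mulVec]; rfl
    rw [mulVec, dotProduct] at h2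
    simp only [Pi.sub_apply, Finset.sum_apply, Pi.zero_apply, Pi.smul_apply,
      MulOpposite.smul_eq_mul_unop, MulOpposite.unop_op]
    rw [sub_eq_zero, mul_comm]
    exact h2.symm
  have hle : J.rank ≤ J'.rank := by
    rw [← hr]
    have h2 := Matrix.rank_submatrix_le J' id cols
    have h3 := Matrix.rank_of_det_ne_zero hdet
    rw [Fintype.card_fin] at h3
    exact h3.symm.le.trans h2
  have hker : LinearMap.ker J.mulVecLin = LinearMap.ker J'.mulVecLin := by
    refine Submodule.eq_of_le_of_finrank_le (fun v hv => ?_) ?_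
    · rw [LinearMap.mem_ker, mulVecLin_apply] at hv ⊢
      ext b
      exact congrFun hv (rows b)
    · have e1 := LinearMap.finrank_range_add_finrank_ker J.mulVecLin
      have e2 := LinearMap.finrank_range_add_finrank_ker J'.mulVecLin
      rw [Matrix.rank, Matrix.rank] at hle
      omega
  have h4 : kernelVector J rows cols j ∈ LinearMap.ker J'.mulVecLin := h1
  rw [← hker] at h4
  exact h4

theorem map_kernelVector {R S : Type*} [CommRing R] [CommRing S] (φ : R →+* S) {N n r : ℕ}
    (J : Matrix (Fin N) (Fin n) R) (rows : Fin r → Fin N) (cols : Fin r → Fin n) (j l : Fin n) :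
    φ (kernelVector J rows cols j l) = kernelVector (J.map φ) rows cols j l := by
  have h1 : (J.map φ).submatrix rows cols = (J.submatrix rows cols).map φ := rfl
  have h2 : ∀ (i : Fin n) (x : R), φ ((Pi.single i x : Fin n → R) l) =
      (Pi.single i (φ x) : Fin n → S) l := fun i x => by
    by_cases h : l = i
    · subst h; simp
    · simp [Pi.single_eq_of_ne h]
  have h3 : ((J.submatrix rows cols).map φ).adjugate = (J.submatrix rows cols).adjugate.map φ :=
    (RingHom.map_adjugate φ _).symm
  simp only [kernelVector, Pi.sub_apply, Finset.sum_apply, map_sub, map_sum, h2, h1, h3]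
  rw [← RingHom.mapMatrix_apply, ← RingHom.map_det]
  simp [mulVec, dotProduct]

theorem mem_deflate_iff {K : Type*} [Field K] {f : PolySystem K n} {r : ℕ} {rows : Fin r → Fin f.length}
    {cols : Fin r → Fin n} {S : Finset (Fin n)} {p : MvPolynomial (Fin n) K} :
    p ∈ deflate f rows cols S ↔ p ∈ f ∨ ∃ j ∈ S, ∃ q ∈ f,
      applyDifferential (kernelVector (jacobian f) rows cols j) q = p := by
  simp [deflate]

variable {K : Type*} [Field K] [Algebra K ℂ]

/-! ### The inverse system -/

theorem mem_inverseSystem_iff {f : PolySystem K n} {ξ : Fin n → ℂ} {Λ : MvPolynomial (Fin n) ℂ} :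
    Λ ∈ inverseSystem f ξ ↔ ∀ q ∈ systemIdeal f, differentialForm ξ Λ q = 0 := by
  rw [inverseSystem, Submodule.mem_comap, Submodule.mem_dualAnnihilator]
  rfl

theorem pderiv_mem_inverseSystem {f : PolySystem K n} {ξ : Fin n → ℂ}
    {Λ : MvPolynomial (Fin n) ℂ} (h : Λ ∈ inverseSystem f ξ) (i : Fin n) :
    pderiv i Λ ∈ inverseSystem f ξ := by
  rw [mem_inverseSystem_iff] at h ⊢
  intro q hq
  rw [differentialForm_pderiv]
  exact h _ (Ideal.mul_mem_left _ _ hq)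

theorem IsRoot.C_mem_inverseSystem {f : PolySystem K n} {ξ : Fin n → ℂ} (h : IsRoot f ξ) (c : ℂ) :
    C c ∈ inverseSystem f ξ := by
  rw [mem_inverseSystem_iff]
  intro q hq
  rw [differentialForm_C, (mem_vanishingIdeal_singleton_iff ξ q).1 (h.systemIdeal_le hq), mul_zero]

theorem inverseSystem_le_degreeLT_of_inf_le {f : PolySystem K n} {ξ : Fin n → ℂ} {o : ℕ}
    (h : inverseSystem f ξ ⊓ degreeLT n (o + 2) ≤ degreeLT n (o + 1)) :
    inverseSystem f ξ ≤ degreeLT n (o + 1) := by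
  have key : ∀ k, inverseSystem f ξ ⊓ degreeLT n (o + 1 + k) ≤ degreeLT n (o + 1) := by
    intro k
    induction k with
    | zero => exact inf_le_right
    | succ k ih =>
      rintro Λ ⟨hΛ, hd⟩
      refine h ⟨hΛ, mem_degreeLT_succ_of_pderiv fun i => ih ?_⟩
      exact ⟨pderiv_mem_inverseSystem hΛ i, pderiv_mem_degreeLT hd i⟩
  intro Λ hΛ
  obtain ⟨d, hd⟩ := exists_mem_degreeLT Λ
  exact key d ⟨hΛ, degreeLT_mono (by omega) hd⟩

theorem IsIsolatedRoot.exists_inverseSystem_le_degreeLT {f : PolySystem K n} {ξ : Fin n → ℂ}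
    (h : IsIsolatedRoot f ξ) : ∃ d, inverseSystem f ξ ≤ degreeLT n (d + 1) := by
  have h1 : ∀ i, ∃ s ∉ vanishingIdeal ℂ {ξ}, ∃ N : ℕ,
      s * (X i - C (ξ i)) ^ N ∈ systemIdeal f := fun i =>
    exists_mul_pow_mem_of_mem_minimalPrimes h.mem_minimalPrimes
      (by rw [mem_vanishingIdeal_singleton_iff]; simp)
  choose s hs N hN using h1
  have h2 : ∀ (Λ : MvPolynomial (Fin n) ℂ) (i : Fin n) (M : ℕ) (q),
      differentialForm ξ ((pderiv i)^[M] Λ) q =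
        differentialForm ξ Λ ((X i - C (ξ i)) ^ M * q) := by
    intro Λ i M
    induction M with
    | zero => intro q; simp
    | succ M ih =>
      intro q
      rw [Function.iterate_succ_apply', differentialForm_pderiv, ih, pow_succ, mul_assoc]
  refine ⟨∑ i, N i, fun Λ hΛ β hβ => ?_⟩
  rw [mem_inverseSystem_iff] at hΛ
  obtain ⟨i, hi⟩ : ∃ i, N i ≤ β i := by
    by_contra! hlt
    rw [Finsupp.degree_eq_sum] at hβ
    have := Finset.sum_le_sum fun i (_ : i ∈ Finset.univ) => (hlt i).le
    omega
  refine coeff_eq_zero_of_iterate_pderiv_eq_zero i (N i) Λ ?_ β hi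
  refine eq_zero_of_differentialForm_mul_eq_zero (ξ := ξ) (s := s i)
    (fun h0 => hs i ((mem_vanishingIdeal_singleton_iff ξ _).2 h0)) fun q => ?_
  rw [h2]
  refine hΛ _ ?_
  rw [show (X i - C (ξ i)) ^ N i * (s i * q) = q * (s i * (X i - C (ξ i)) ^ N i) by ring]
  exact Ideal.mul_mem_left _ _ (hN i)

theorem inverseSystem_le_degreeLT_nilIndex {f : PolySystem K n} {ξ : Fin n → ℂ}
    (h : IsIsolatedRoot f ξ) : inverseSystem f ξ ≤ degreeLT n (nilIndex f ξ + 1) := by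
  obtain ⟨d, hd⟩ := h.exists_inverseSystem_le_degreeLT
  have hne : {t : ℕ | inverseSystemLE f ξ (t + 1) = inverseSystemLE f ξ t}.Nonempty := by
    refine ⟨d, ?_⟩
    simp only [Set.mem_ofPred_eq, inverseSystemLE, restrictTotalDegree_eq_degreeLT]
    rw [inf_eq_left.2 hd, inf_eq_left.2 (hd.trans (degreeLT_mono (Nat.le_succ _)))]
  have hmem : nilIndex f ξ ∈ {t : ℕ | inverseSystemLE f ξ (t + 1) = inverseSystemLE f ξ t} :=
    Nat.sInf_mem hne
  simp only [Set.mem_ofPred_eq, inverseSystemLE, restrictTotalDegree_eq_degreeLT] at hmem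
  exact inverseSystem_le_degreeLT_of_inf_le (hmem.le.trans inf_le_right)

/-- A root at which the Jacobian matrix has full column rank is simple. -/
theorem IsRoot.isSimpleRoot_of_rank_eq {f : PolySystem K n} {ξ : Fin n → ℂ} (h : IsRoot f ξ)
    (hr : (jacobianAt f ξ).rank = n) : IsSimpleRoot f ξ := by
  refine ⟨h, ?_⟩
  have hle : inverseSystem f ξ ≤ degreeLT n 1 := by
    refine inverseSystem_le_degreeLT_of_inf_le (o := 0) ?_
    rintro Λ ⟨hΛ, hd⟩
    have hb := fun i => eq_C_of_mem_degreeLT_one (pderiv_mem_degreeLT hd i)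
    set b : Fin n → ℂ := fun i => coeff 0 (pderiv i Λ) with hbdef
    have h1 : Λ - ∑ i, C (b i) * X i ∈ degreeLT n 1 := mem_degreeLT_succ_of_pderiv fun i => by
      classical
      have : pderiv i (Λ - ∑ j, C (b j) * X j) = 0 := by
        rw [map_sub, map_sum, hb i]
        simp [pderiv_X, Pi.single_apply, hbdef]
      rw [this]; exact zero_mem _
    have h2 : jacobianAt f ξ *ᵥ b = 0 := by
      ext k
      have h3 := mem_inverseSystem_iff.1 hΛ _
        (Ideal.subset_span ⟨f.get k, List.get_mem f k, rfl⟩)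
      rw [← sub_add_cancel Λ (∑ i, C (b i) * X i), eq_C_of_mem_degreeLT_one h1, map_add, map_sum,
        LinearMap.add_apply, LinearMap.sum_apply, differentialForm_C, aeval_map_eq,
        h _ (List.get_mem f k), mul_zero, zero_add] at h3
      simp only [differentialForm_mul_X, differentialForm_C, pderiv_map, aeval_map_eq] at h3
      rw [Pi.zero_apply, ← h3, mulVec, dotProduct]
      exact Finset.sum_congr rfl fun i _ => mul_comm _ _
    have h4 : LinearMap.ker (jacobianAt f ξ).mulVecLin = ⊥ := by
      have e1 := LinearMap.finrank_range_add_finrank_ker (jacobianAt f ξ).mulVecLin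
      rw [Matrix.rank] at hr
      rw [hr, Module.finrank_fin_fun] at e1
      exact Submodule.finrank_eq_zero.1 (by omega)
    have h5 : b = 0 := by
      have : b ∈ LinearMap.ker (jacobianAt f ξ).mulVecLin := h2
      rwa [h4, Submodule.mem_bot] at this
    simpa [h5] using h1
  have heq : inverseSystem f ξ = Submodule.span ℂ {1} := by
    apply le_antisymm
    · intro Λ hΛ
      rw [eq_C_of_mem_degreeLT_one (hle hΛ), Submodule.mem_span_singleton]
      exact ⟨coeff 0 Λ, by rw [smul_eq_C_mul, mul_one]⟩
    · rw [Submodule.span_singleton_le_iff_mem]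
      simpa using h.C_mem_inverseSystem 1
  rw [multiplicity, heq]
  exact finrank_span_singleton one_ne_zero

/-! ### Deflation -/

theorem exists_isDeflatedSystem {f : PolySystem K n} {ξ : Fin n → ℂ}
    (h : (jacobianAt f ξ).rank ≠ n) : ∃ g, IsDeflatedSystem ξ f g := by
  obtain ⟨rows, cols, hdet⟩ := exists_submatrix_det_ne_zero (jacobianAt f ξ)
  have hlt : (jacobianAt f ξ).rank < n := lt_of_le_of_ne (Matrix.rank_le_width _) h
  obtain ⟨j, hj⟩ := range_ne_univ_of_lt hlt cols
  exact ⟨_, _, rows, cols, {j}, rfl, hdet, Finset.singleton_nonempty j,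
    fun i hi => Finset.mem_singleton.1 hi ▸ hj, rfl⟩

theorem aeval_kernelVector {f : PolySystem K n} (ξ : Fin n → ℂ) {r : ℕ}
    (rows : Fin r → Fin f.length) (cols : Fin r → Fin n) (j l : Fin n) :
    aeval ξ (kernelVector (jacobian f) rows cols j l) =
      kernelVector (jacobianAt f ξ) rows cols j l :=
  map_kernelVector (aeval ξ : MvPolynomial (Fin n) K →ₐ[K] ℂ).toRingHom _ _ _ _ _

theorem IsDeflatedSystem.isRoot {f g : PolySystem K n} {ξ : Fin n → ℂ}
    (h : IsDeflatedSystem ξ f g) (hf : IsRoot f ξ) : IsRoot g ξ := by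
  obtain ⟨r, rows, cols, S, hr, hdet, -, -, rfl⟩ := h
  intro p hp
  rcases mem_deflate_iff.1 hp with hp | ⟨j, -, q, hq, rfl⟩
  · exact hf p hp
  · obtain ⟨k, rfl⟩ := List.get_of_mem hq
    have h1 := congrFun (mulVec_kernelVector hr hdet j) k
    rw [mulVec, dotProduct, Pi.zero_apply] at h1
    rw [applyDifferential, map_sum, ← h1]
    refine Finset.sum_congr rfl fun l _ => ?_
    rw [map_mul, aeval_kernelVector, mul_comm]
    rfl

theorem sum_mul_pderiv_mem {f : PolySystem K n} {I : Ideal (MvPolynomial (Fin n) ℂ)}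
    (hI : systemIdeal f ≤ I) (lam : Fin n → MvPolynomial (Fin n) K)
    (h : ∀ p ∈ f, MvPolynomial.map (algebraMap K ℂ) (applyDifferential lam p) ∈ I)
    {q : MvPolynomial (Fin n) ℂ} (hq : q ∈ systemIdeal f) :
    ∑ l, MvPolynomial.map (algebraMap K ℂ) (lam l) * pderiv l q ∈ I := by
  induction hq using Submodule.span_induction with
  | mem q hq =>
    obtain ⟨p, hp, rfl⟩ := hq
    have := h p hp
    rw [applyDifferential, map_sum] at this
    simpa only [map_mul, pderiv_map] using this
  | zero => simp
  | add p q _ _ hp hq =>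
    simp only [map_add, mul_add, Finset.sum_add_distrib]
    exact add_mem hp hq
  | smul a q hq ih =>
    have : ∑ l, MvPolynomial.map (algebraMap K ℂ) (lam l) * pderiv l (a • q) =
        a * (∑ l, MvPolynomial.map (algebraMap K ℂ) (lam l) * pderiv l q) +
        (∑ l, MvPolynomial.map (algebraMap K ℂ) (lam l) * pderiv l a) * q := by
      rw [Finset.mul_sum, Finset.sum_mul, ← Finset.sum_add_distrib]
      refine Finset.sum_congr rfl fun l _ => ?_
      rw [smul_eq_mul, pderiv_mul]
      ring
    rw [this]
    exact add_mem (Ideal.mul_mem_left _ _ ih) (Ideal.mul_mem_left _ _ (hI hq))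

/-- Deflation lowers the order of the inverse system. -/
theorem IsDeflatedSystem.inverseSystem_le_degreeLT {f g : PolySystem K n} {ξ : Fin n → ℂ}
    (h : IsDeflatedSystem ξ f g) {m : ℕ} (hf : inverseSystem f ξ ≤ degreeLT n (m + 1)) :
    inverseSystem g ξ ≤ degreeLT n m := by
  obtain ⟨r, rows, cols, S, -, hdet, ⟨j, hjS⟩, hS, rfl⟩ := h
  set lam := kernelVector (jacobian f) rows cols j with hlam
  have hI : systemIdeal f ≤ systemIdeal (deflate f rows cols S) := by
    refine Ideal.span_mono ?_
    rintro _ ⟨p, hp, rfl⟩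
    exact ⟨p, mem_deflate_iff.2 (Or.inl hp), rfl⟩
  intro Λ hΛ
  rw [mem_inverseSystem_iff] at hΛ
  have hΛd : Λ ∈ degreeLT n (m + 1) :=
    hf (mem_inverseSystem_iff.2 fun q hq => hΛ q (hI hq))
  choose Λl hpair hdeg using fun l =>
    exists_differentialForm_eq_mul ξ Λ (MvPolynomial.map (algebraMap K ℂ) (lam l))
  have h1 : ∑ l, Λl l * X l ∈ inverseSystem f ξ := by
    rw [mem_inverseSystem_iff]
    intro q hq
    rw [map_sum, LinearMap.sum_apply]
    simp only [differentialForm_mul_X, hpair]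
    rw [← map_sum]
    refine hΛ _ (sum_mul_pderiv_mem hI lam (fun p hp => ?_) hq)
    exact Ideal.subset_span ⟨_, mem_deflate_iff.2 (Or.inr ⟨j, hjS, p, hp, rfl⟩), rfl⟩
  have ha : (fun l => aeval ξ (lam l) : Fin n → ℂ) ≠ 0 := by
    refine Function.ne_iff.2 ⟨j, ?_⟩
    simp only [hlam, aeval_kernelVector, Pi.zero_apply]
    have hj := hS j hjS
    have : kernelVector (jacobianAt f ξ) rows cols j j =
        ((jacobianAt f ξ).submatrix rows cols).det := by
      rw [kernelVector, Pi.sub_apply, Pi.single_eq_same, Finset.sum_apply,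
        Finset.sum_eq_zero, sub_zero]
      intro a _
      exact Pi.single_eq_of_ne (fun he => hj ⟨a, he.symm⟩) _
    rw [this]
    exact hdet
  refine mem_degreeLT_of_linear_mul_mem ha ?_
  have h2 : ∑ l, (Λl l - aeval ξ (lam l) • Λ) * X l ∈ degreeLT n (m + 1) := by
    refine Submodule.sum_mem _ fun l _ => mul_X_mem_degreeLT ?_ l
    have := hdeg l m hΛd
    rwa [aeval_map_eq] at this
  have h3 := sub_mem (hf h1) h2
  rw [← Finset.sum_sub_distrib] at h3
  convert h3 using 2 with l
  rw [sub_mul, smul_mul_assoc]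
  abel

theorem exists_isSimpleRoot_of_inverseSystem_le {ξ : Fin n → ℂ} {m : ℕ} {F : ℕ → PolySystem K n}
    (hroot : IsRoot (F 0) ξ) (hm : inverseSystem (F 0) ξ ≤ degreeLT n (m + 1))
    (hF : ∀ k, (∃ g, IsDeflatedSystem ξ (F k) g) → IsDeflatedSystem ξ (F k) (F (k + 1))) :
    ∃ k ≤ m, (∀ j < k, IsDeflatedSystem ξ (F j) (F (j + 1))) ∧ IsSimpleRoot (F k) ξ := by
  induction m generalizing F with
  | zero =>
    by_cases hr : (jacobianAt (F 0) ξ).rank = n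
    · exact ⟨0, le_rfl, by simp, hroot.isSimpleRoot_of_rank_eq hr⟩
    · have hdef := hF 0 (exists_isDeflatedSystem hr)
      have h1 := hdef.inverseSystem_le_degreeLT hm ((hdef.isRoot hroot).C_mem_inverseSystem 1)
      exact absurd (eq_zero_of_mem_degreeLT_zero h1) (by simp)
  | succ m ih =>
    by_cases hr : (jacobianAt (F 0) ξ).rank = n
    · exact ⟨0, Nat.zero_le _, by simp, hroot.isSimpleRoot_of_rank_eq hr⟩
    · have hdef := hF 0 (exists_isDeflatedSystem hr)
      obtain ⟨k, hk, hchain, hsimple⟩ := ih (F := fun k => F (k + 1)) (hdef.isRoot hroot)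
        (hdef.inverseSystem_le_degreeLT hm) fun k => hF (k + 1)
      refine ⟨k + 1, by omega, fun j hj => ?_, hsimple⟩
      cases j with
      | zero => exact hdef
      | succ j => exact hchain j (by omega)

end Deflation
end
theorem mainTheorem2 {K : Type*} [Field K] [Algebra K ℂ] {n : ℕ}
    (f : Deflation.PolySystem K n) (ξ : Fin n → ℂ) (hξ : Deflation.IsIsolatedRoot f ξ)
    (F : ℕ → Deflation.PolySystem K n) (hF_zero : F 0 = f)
    (hF_succ : ∀ k, (∃ g, Deflation.IsDeflatedSystem ξ (F k) g) →
      Deflation.IsDeflatedSystem ξ (F k) (F (k + 1))) :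
    ∃ k ≤ Deflation.nilIndex f ξ,
      (∀ j < k, Deflation.IsDeflatedSystem ξ (F j) (F (j + 1))) ∧
      Deflation.IsSimpleRoot (F k) ξ := by
  subst hF_zero
  exact Deflation.exists_isSimpleRoot_of_inverseSystem_le hξ.1
    (Deflation.inverseSystem_le_degreeLT_nilIndex hξ) hF_succ
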